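/- Let $\mathcal S,\mathcal A$ be finite non-empty sets and let $(\mathcal S,\mathcal A,P,r,\gamma)$ be a Markov decision process with transition probabilities $P(\cdot|s,a)$, rewards $r(s,a)\in[0,1]$ and discount factor $\gamma\in[0,1)$. Let $\tau>0$. For a policy $\pi=(\pi(\cdot|s))_{s\in\mathcal S}$ (each $\pi(\cdot|s)$ a probability vector on $\mathcal A$) put $$V_\tau^\pi(s)=\mathbb E\Big[\sum_{t=0}^\infty\gamma^t\big(r(s_t,a_t)-\tau\log\pi(a_t|s_t)\big)\,\Big|\,s_0=s,\pi\Big],$$ where $a_t\sim\pi(\cdot|s_t)$ and $s_{t+1}\sim P(\cdot|s_t,a_t)$, and $$Q_\tau^\pi(s,a)=\mathbb E_{s'\sim P(\cdot|s,a)}\big[r(s,a)+\gamma V_\tau^\pi(s')\big],\qquad A_\tau^\pi(s,a)=Q_\tau^\pi(s,a)-\tau\log\pi(a|s)-V_\tau^\pi(s).$$ Then there is a unique optimal policy $\pi^*$, that is, a unique policy with $V_\tau^{\pi}(s)\le V_\tau^{\pi^*}(s)$ for all policies $\pi$ and all $s$; write $V_\tau^*=V_\tau^{\pi^*}$ and $Q_\tau^*=Q_\tau^{\pi^*}$.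 Let $\eta>0$ be any constant step size, let $\pi^0$ be a policy with $\pi^0(a|s)>0$ for all $s,a$, and let $\pi^0,\pi^1,\pi^2,\dots$ be generated by entropy softmax NPG, $$\pi^{k+1}(a|s)=\frac{\pi^k(a|s)\exp\big(\tfrac{\eta}{\eta\tau+1}A_\tau^{\pi^k}(s,a)\big)}{\sum_{a'}\pi^k(a'|s)\exp\big(\tfrac{\eta}{\eta\tau+1}A_\tau^{\pi^k}(s,a')\big)} .$$ Write $V_\tau^k=V_\tau^{\pi^k}$ and $Q_\tau^k=Q_\tau^{\pi^k}$. Then for every integer $k\ge1$, $$\|V_\tau^*-V_\tau^k\|_\infty\le\frac{2\,C_1^2}{(1-\gamma)\,\tau}\Big(1-(1-\gamma)\frac{\eta\tau}{\eta\tau+1}\Big)^{2(k-1)},$$ where $$C_1=\|Q_\tau^*-Q_\tau^0\|_\infty+2\tau\Big(1-\frac{\eta\tau}{1+\eta\tau}\Big)\|\log\pi^*-\log\pi^0\|_\infty$$ and $\|\cdot\|_\infty$ denotes the maximum over all states, respectively over all state-action pairs. -/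

import Mathlib

open MeasureTheory ProbabilityTheory

noncomputable section

/-- A finite discounted Markov decision process `(S, A, P, r, γ)` with `P s a` a probability vector
on `S`, rewards in `[0, 1]` and discount factor in `[0, 1)`. -/
structure FiniteMDP (S A : Type*) [Fintype S] where
  P : S → A → S → ℝ
  P_mem : ∀ s a, P s a ∈ stdSimplex ℝ S
  r : S → A → ℝ
  r_mem : ∀ s a, r s a ∈ Set.Icc (0 : ℝ) 1
  γ : ℝ
  γ_nonneg : 0 ≤ γ
  γ_lt_one : γ < 1

/-- A policy: for each state `s` a probability vector `prob s` on the actions. -/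
@[ext]
structure Policy (S A : Type*) [Fintype A] where
  prob : S → A → ℝ
  prob_mem : ∀ s, prob s ∈ stdSimplex ℝ A

/-- The measure on a finite set with the given (nonnegative) point weights. -/
def finLaw {X : Type*} [Fintype X] [MeasurableSpace X] (p : X → ℝ) : Measure X :=
  ∑ x, ENNReal.ofReal (p x) • Measure.dirac x

theorem finLaw_isProbabilityMeasure {X : Type*} [Fintype X] [MeasurableSpace X] {p : X → ℝ}
    (hp : p ∈ stdSimplex ℝ X) : IsProbabilityMeasure (finLaw p) := by
  constructor
  simp only [finLaw, Measure.coe_finsetSum, Finset.sum_apply, Measure.smul_apply, measure_univ,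
    smul_eq_mul, mul_one]
  rw [← ENNReal.ofReal_sum_of_nonneg (fun x _ => hp.1 x), hp.2, ENNReal.ofReal_one]

namespace FiniteMDP

variable {S A : Type*} [Fintype S] [Fintype A]

/-- Probability of moving from the state-action pair `x` to the pair `y` under `π`: the next state
is drawn from `P(· | x)` and the next action from `π(· | next state)`. -/
def stepProb (M : FiniteMDP S A) (π : Policy S A) (x y : S × A) : ℝ :=
  M.P x.1 x.2 y.1 * π.prob y.1 y.2

theorem stepProb_mem (M : FiniteMDP S A) (π : Policy S A) (x : S × A) :
    M.stepProb π x ∈ stdSimplex ℝ (S × A) := by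
  refine ⟨fun y => mul_nonneg ((M.P_mem x.1 x.2).1 _) ((π.prob_mem _).1 _), ?_⟩
  rw [Fintype.sum_prod_type]
  simp only [stepProb, ← Finset.mul_sum, (π.prob_mem _).2, mul_one, (M.P_mem x.1 x.2).2]

section Trajectory

variable [MeasurableSpace S] [DiscreteMeasurableSpace S]
  [MeasurableSpace A] [DiscreteMeasurableSpace A]

/-- The law of the first pair `(s₀, a₀)`: `s₀ = s` and `a₀ ∼ π(· | s)`. -/
def initLaw (π : Policy S A) (s : S) : Measure (S × A) :=
  (finLaw (π.prob s)).map (Prod.mk s)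

instance initLaw_isProbabilityMeasure (π : Policy S A) (s : S) :
    IsProbabilityMeasure (initLaw π s) := by
  have := finLaw_isProbabilityMeasure (π.prob_mem s)
  exact Measure.isProbabilityMeasure_map measurable_prodMk_left.aemeasurable

/-- The one-step transition kernel of the state-action chain under `π`. -/
def stepKernel (M : FiniteMDP S A) (π : Policy S A) : Kernel (S × A) (S × A) where
  toFun x := finLaw (M.stepProb π x)
  measurable' := Measurable.of_discrete

instance stepKernel_isMarkovKernel (M : FiniteMDP S A) (π : Policy S A) :
    IsMarkovKernel (M.stepKernel π) :=
  ⟨fun x => finLaw_isProbabilityMeasure (M.stepProb_mem π x)⟩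

/-- The law of the next pair given the history up to time `n`; it depends on the last pair only. -/
def histKernel (M : FiniteMDP S A) (π : Policy S A) (n : ℕ) :
    Kernel ((i : Finset.Iic n) → (fun _ : ℕ => S × A) i) (S × A) :=
  (M.stepKernel π).comap (fun h => h ⟨n, Finset.mem_Iic.2 le_rfl⟩) (measurable_pi_apply _)

instance histKernel_isMarkovKernel (M : FiniteMDP S A) (π : Policy S A) (n : ℕ) :
    IsMarkovKernel (M.histKernel π n) := by
  unfold histKernel
  infer_instance

/-- The law of the random trajectory `(s₀, a₀), (s₁, a₁), …` induced by `π` and started at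
`s₀ = s`. -/
def trajLaw (M : FiniteMDP S A) (π : Policy S A) (s : S) : Measure (ℕ → S × A) :=
  Kernel.trajMeasure (X := fun _ => S × A) (initLaw π s) (M.histKernel π)

/-- The entropy regularized state value
`V_τ^π(s) = 𝔼[∑ₜ γᵗ (r(sₜ, aₜ) - τ log π(aₜ | sₜ)) | s₀ = s, π]`. -/
def V (M : FiniteMDP S A) (τ : ℝ) (π : Policy S A) (s : S) : ℝ :=
  ∫ ω, ∑' t : ℕ, M.γ ^ t *
    (M.r (ω t).1 (ω t).2 - τ * Real.log (π.prob (ω t).1 (ω t).2)) ∂(M.trajLaw π s)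

/-- The entropy regularized action value `Q_τ^π(s,a) = 𝔼_{s' ∼ P(·|s,a)}[r(s,a) + γ V_τ^π(s')]`. -/
def Q (M : FiniteMDP S A) (τ : ℝ) (π : Policy S A) (s : S) (a : A) : ℝ :=
  ∑ s', M.P s a s' * (M.r s a + M.γ * M.V τ π s')

/-- The entropy regularized advantage `A_τ^π(s,a) = Q_τ^π(s,a) - τ log π(a|s) - V_τ^π(s)`. -/
def adv (M : FiniteMDP S A) (τ : ℝ) (π : Policy S A) (s : S) (a : A) : ℝ :=
  M.Q τ π s a - τ * Real.log (π.prob s a) - M.V τ π s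

/-- `π` is optimal for the entropy regularized problem: it attains the maximal value over all
policies at every state. Then `V_τ^* = V_τ^π` and `Q_τ^* = Q_τ^π`. -/
def IsOptimal (M : FiniteMDP S A) (τ : ℝ) (π : Policy S A) : Prop :=
  ∀ (π' : Policy S A) (s : S), M.V τ π' s ≤ M.V τ π s

/-- One step of entropy softmax NPG with step size `η`: the policy
`π⁺(a|s) ∝ π(a|s) exp(η / (η τ + 1) * A_τ^π(s,a))`. -/
def npgStep (M : FiniteMDP S A) (τ η : ℝ) (π : Policy S A) : Policy S A where
  prob s a := π.prob s a * Real.exp (η / (η * τ + 1) * M.adv τ π s a) /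
    ∑ b, π.prob s b * Real.exp (η / (η * τ + 1) * M.adv τ π s b)
  prob_mem s := by
    have hnn : ∀ b, 0 ≤ π.prob s b * Real.exp (η / (η * τ + 1) * M.adv τ π s b) :=
      fun b => mul_nonneg ((π.prob_mem s).1 b) (Real.exp_pos _).le
    refine ⟨fun a => div_nonneg (hnn a) (Finset.sum_nonneg fun b _ => hnn b), ?_⟩
    rw [← Finset.sum_div]
    refine div_self fun h0 => ?_
    have hz : ∀ b, π.prob s b = 0 := fun b => by
      have := (Finset.sum_eq_zero_iff_of_nonneg fun b _ => hnn b).1 h0 b (Finset.mem_univ b)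
      exact (mul_eq_zero.1 this).resolve_right (Real.exp_pos _).ne'
    have h1 := (π.prob_mem s).2
    simp [hz] at h1

/-- The policy sequence `π⁰, π¹, π², …` of entropy softmax NPG with constant step size `η`. -/
def npgIter (M : FiniteMDP S A) (τ η : ℝ) (π₀ : Policy S A) : ℕ → Policy S A
  | 0 => π₀
  | k + 1 => M.npgStep τ η (npgIter M τ η π₀ k)

/-- `C₁ = ‖Q_τ^* - Q_τ^0‖_∞ + 2 τ (1 - ητ/(1+ητ)) ‖log π^* - log π⁰‖_∞`, with maximum norms over
all state-action pairs. -/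
def C₁ (M : FiniteMDP S A) (τ η : ℝ) (πstar π₀ : Policy S A) : ℝ :=
  ‖M.Q τ πstar - M.Q τ π₀‖ + 2 * τ * (1 - η * τ / (1 + η * τ)) *
    ‖(fun (s : S) (a : A) => Real.log (πstar.prob s a) - Real.log (π₀.prob s a))‖

end Trajectory

end FiniteMDP

end

/-! Everything rests on the Gibbs variational principle: `freeVal τ p u` is at most `lse τ u`, the
gap is `τ` times the relative entropy of `p` with respect to `softmax τ u`, and it vanishes only at
`p = softmax τ u`. The Bellman equation reads `V = freeVal` of the lookahead of `V`, and the optimal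
value is the fixed point of `lse` of the lookahead, a `γ`-contraction. Equality in the variational
principle then forces the optimal policy to be `softmax τ Q*`, which gives uniqueness.

With `β = ητ/(ητ+1)`, every iterate is Gibbs, `π^k = softmax τ u_k`, where `u_{k+1} = (1-β) u_k + β
Q^k`. Let `|Q* - u_k| ≤ d` and `u_k ≤ Q^k + b`. Comparing free values gives `0 ≤ Q* - Q^k ≤ γ(d+b)`,
and policy improvement `Q^k ≤ Q^{k+1}` shrinks `b` to `(1-β)b`. Hence `d+b` contracts by `1-(1-γ)β`
per step (`npgLogits_error`).

The square in the rate comes from the end: `Q*` is evaluated under a Gibbs policy whose potential is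
off by `d`, and since the Gibbs policy of `Q*` is a maximizer, the loss is of second order, at most
`2d²/τ` (`lse_sub_freeVal_softmax_le`). Propagating this one-step loss costs the factor `1/(1-γ)`.
-/

noncomputable section

/-! ### Expectations along the trajectory and the Bellman equation -/

theorem integral_finLaw {X : Type*} [Fintype X] [MeasurableSpace X] [DiscreteMeasurableSpace X]
    {p : X → ℝ} (hp : ∀ x, 0 ≤ p x) (g : X → ℝ) : ∫ x, g x ∂(finLaw p) = ∑ x, p x * g x := by
  have hint : ∀ x ∈ Finset.univ, Integrable g (ENNReal.ofReal (p x) • Measure.dirac x) :=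
    fun x _ => (integrable_dirac (by simp)).smul_measure ENNReal.ofReal_ne_top
  rw [finLaw, integral_finsetSum_measure hint]
  refine Finset.sum_congr rfl fun x _ => ?_
  rw [integral_smul_measure, integral_dirac, ENNReal.toReal_ofReal (hp x), smul_eq_mul]

namespace FiniteMDP

variable {S A : Type*} [Fintype S] [Fintype A]

/-- The transition operator of the state-action chain under `π`. -/
def stepOp (M : FiniteMDP S A) (π : Policy S A) (g : S × A → ℝ) (x : S × A) : ℝ :=
  ∑ y, M.stepProb π x y * g y

theorem stepOp_eq (M : FiniteMDP S A) (π : Policy S A) (g : S × A → ℝ) (x : S × A) :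
    M.stepOp π g x = ∑ s', M.P x.1 x.2 s' * ∑ a', π.prob s' a' * g (s', a') := by
  simp only [stepOp, stepProb, Fintype.sum_prod_type, Finset.mul_sum, mul_assoc]

theorem abs_sum_mul_le {X : Type*} [Fintype X] {p : X → ℝ} (hp : p ∈ stdSimplex ℝ X)
    {g : X → ℝ} {B : ℝ} (hg : ∀ x, |g x| ≤ B) : |∑ x, p x * g x| ≤ B := by
  calc |∑ x, p x * g x| ≤ ∑ x, |p x * g x| := Finset.abs_sum_le_sum_abs _ _
    _ ≤ ∑ x, p x * B := Finset.sum_le_sum fun x _ => by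
        rw [abs_mul, abs_of_nonneg (hp.1 x)]
        exact mul_le_mul_of_nonneg_left (hg x) (hp.1 x)
    _ = B := by rw [← Finset.sum_mul, hp.2, one_mul]

theorem abs_stepOp_iterate_le (M : FiniteMDP S A) (π : Policy S A) {g : S × A → ℝ} {B : ℝ}
    (hg : ∀ x, |g x| ≤ B) (t : ℕ) (x : S × A) : |(M.stepOp π)^[t] g x| ≤ B := by
  induction t generalizing x with
  | zero => exact hg x
  | succ t ih =>
    rw [Function.iterate_succ_apply']
    exact abs_sum_mul_le (M.stepProb_mem π x) ih

/-- The reward with entropy bonus collected at a state-action pair. -/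
def regReward (M : FiniteMDP S A) (τ : ℝ) (π : Policy S A) (x : S × A) : ℝ :=
  M.r x.1 x.2 - τ * Real.log (π.prob x.1 x.2)

/-- The discounted sum of expected regularized rewards from a state-action pair on. -/
def pairValue (M : FiniteMDP S A) (τ : ℝ) (π : Policy S A) (x : S × A) : ℝ :=
  ∑' t : ℕ, M.γ ^ t * (M.stepOp π)^[t] (M.regReward τ π) x

/-- Finiteness of `S × A` suffices even when some probabilities vanish, because `Real.log 0 = 0`. -/
theorem exists_abs_regReward_le (M : FiniteMDP S A) (τ : ℝ) (π : Policy S A) :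
    ∃ B, ∀ x, |M.regReward τ π x| ≤ B := by
  obtain ⟨B, hB⟩ := (Set.finite_range fun x => |M.regReward τ π x|).bddAbove
  exact ⟨B, fun x => hB ⟨x, rfl⟩⟩

theorem summable_pairValue (M : FiniteMDP S A) (τ : ℝ) (π : Policy S A) (x : S × A) :
    Summable fun t : ℕ => M.γ ^ t * (M.stepOp π)^[t] (M.regReward τ π) x := by
  obtain ⟨B, hB⟩ := M.exists_abs_regReward_le τ π
  refine Summable.of_norm_bounded
    ((summable_geometric_of_lt_one M.γ_nonneg M.γ_lt_one).mul_right B) fun t => ?_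
  rw [norm_mul, Real.norm_of_nonneg (pow_nonneg M.γ_nonneg t)]
  exact mul_le_mul_of_nonneg_left (M.abs_stepOp_iterate_le π hB t x) (pow_nonneg M.γ_nonneg t)

section Trajectory

variable [MeasurableSpace S] [DiscreteMeasurableSpace S]
  [MeasurableSpace A] [DiscreteMeasurableSpace A]

instance trajLaw_isProbabilityMeasure (M : FiniteMDP S A) (π : Policy S A) (s : S) :
    IsProbabilityMeasure (M.trajLaw π s) := by
  unfold trajLaw
  infer_instance

/-- Markov property: the joint law of the history up to `t` and the pair at `t + 1` is the history
law composed with a kernel that sees only the last pair. -/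
theorem integral_trajLaw_succ (M : FiniteMDP S A) (π : Policy S A) (s : S) (g : S × A → ℝ)
    (t : ℕ) :
    ∫ ω, g (ω (t + 1)) ∂(M.trajLaw π s) = ∫ ω, M.stepOp π g (ω t) ∂(M.trajLaw π s) := by
  have hg : Measurable g := Measurable.of_discrete
  have hK : Measurable (M.stepOp π g) := Measurable.of_discrete
  obtain ⟨B, hB⟩ : ∃ B, ∀ x, ‖g x‖ ≤ B := by
    obtain ⟨B, hB⟩ := (Set.finite_range fun x => ‖g x‖).bddAbove
    exact ⟨B, fun x => hB ⟨x, rfl⟩⟩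
  have hg2 (μ : Measure (((i : Finset.Iic t) → (fun _ : ℕ => S × A) i) × (S × A))) :
      AEStronglyMeasurable (fun z => g z.2) μ := (hg.comp measurable_snd).aestronglyMeasurable
  have key := Kernel.map_frestrictLe_trajMeasure_compProd_eq_map_trajMeasure
    (X := fun _ => S × A) (μ₀ := initLaw π s) (κ := M.histKernel π) (a := t)
  change (M.trajLaw π s).map (Preorder.frestrictLe t) ⊗ₘ M.histKernel π t = _ at key
  have : IsProbabilityMeasure ((M.trajLaw π s).map
      (Preorder.frestrictLe (π := fun _ : ℕ => S × A) t)) :=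
    Measure.isProbabilityMeasure_map (by fun_prop)
  have h1 : ∫ ω, g (ω (t + 1)) ∂(M.trajLaw π s) =
      ∫ z, g z.2 ∂((M.trajLaw π s).map (Preorder.frestrictLe t) ⊗ₘ M.histKernel π t) := by
    rw [key, integral_map (by fun_prop) (hg2 _)]
    rfl
  rw [h1, Measure.integral_compProd (Integrable.of_bound (hg2 _) B (Filter.Eventually.of_forall fun z => hB _)),
    integral_map (by fun_prop)]
  · refine integral_congr_ae (Filter.Eventually.of_forall fun ω => ?_)
    change ∫ y, g y ∂(finLaw (M.stepProb π (ω t))) = _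
    rw [integral_finLaw (M.stepProb_mem π _).1]
    rfl
  · have : (fun h => ∫ y, g y ∂(M.histKernel π t h)) =
        fun h => M.stepOp π g (h ⟨t, Finset.mem_Iic.2 le_rfl⟩) := by
      ext h
      change ∫ y, g y ∂(finLaw (M.stepProb π _)) = _
      rw [integral_finLaw (M.stepProb_mem π _).1]
      rfl
    change AEStronglyMeasurable (fun h => ∫ y, g y ∂(M.histKernel π t h)) _
    rw [this]
    exact (hK.comp (measurable_pi_apply _)).aestronglyMeasurable

theorem integral_trajLaw_zero (M : FiniteMDP S A) (π : Policy S A) (s : S) (g : S × A → ℝ) :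
    ∫ ω, g (ω 0) ∂(M.trajLaw π s) = ∑ a, π.prob s a * g (s, a) := by
  have hg : Measurable g := Measurable.of_discrete
  have hmap : (M.trajLaw π s).map (fun ω => ω 0) = initLaw π s := by
    have h : (M.trajLaw π s).map (Preorder.frestrictLe (π := fun _ : ℕ => S × A) 0) =
        (initLaw π s).map (MeasurableEquiv.piUnique
          (fun _ : Finset.Iic 0 => S × A)).symm := by
      rw [trajLaw, Kernel.trajMeasure, Measure.map_comp _ _ (by fun_prop),
        Kernel.traj_map_frestrictLe, Kernel.partialTraj_self, Measure.id_comp]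
    have h' := congrArg (Measure.map (fun x => x ⟨0, Finset.mem_Iic.2 le_rfl⟩)) h
    rw [Measure.map_map (measurable_pi_apply _) (by fun_prop),
      Measure.map_map (measurable_pi_apply _) (by fun_prop)] at h'
    refine Eq.trans h' ?_
    exact Measure.map_id
  have h1 : ∫ ω, g (ω 0) ∂(M.trajLaw π s) = ∫ x, g x ∂(initLaw π s) := by
    rw [← hmap, integral_map (measurable_pi_apply 0).aemeasurable hg.aestronglyMeasurable]
  rw [h1, initLaw, integral_map (by fun_prop) hg.aestronglyMeasurable,
    integral_finLaw (π.prob_mem s).1]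

theorem integral_trajLaw (M : FiniteMDP S A) (π : Policy S A) (s : S) (g : S × A → ℝ) (t : ℕ) :
    ∫ ω, g (ω t) ∂(M.trajLaw π s) = ∑ a, π.prob s a * (M.stepOp π)^[t] g (s, a) := by
  induction t generalizing g with
  | zero => exact M.integral_trajLaw_zero π s g
  | succ t ih => rw [integral_trajLaw_succ, ih, Function.iterate_succ_apply]

theorem V_eq_sum_pairValue (M : FiniteMDP S A) (τ : ℝ) (π : Policy S A) (s : S) :
    M.V τ π s = ∑ a, π.prob s a * M.pairValue τ π (s, a) := by
  obtain ⟨B, hB⟩ := M.exists_abs_regReward_le τ π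
  have hc : Measurable (M.regReward τ π) := Measurable.of_discrete
  have hmeas : ∀ t : ℕ, Measurable fun ω : ℕ → S × A => M.γ ^ t * M.regReward τ π (ω t) :=
    fun t => (hc.comp (measurable_pi_apply t)).const_mul _
  have hle : ∀ (t : ℕ) (ω : ℕ → S × A), ‖M.γ ^ t * M.regReward τ π (ω t)‖ ≤ M.γ ^ t * B := by
    intro t ω
    rw [norm_mul, Real.norm_of_nonneg (pow_nonneg M.γ_nonneg t)]
    exact mul_le_mul_of_nonneg_left (hB _) (pow_nonneg M.γ_nonneg t)
  have hint : ∀ t : ℕ, Integrable (fun ω : ℕ → S × A => M.γ ^ t * M.regReward τ π (ω t))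
      (M.trajLaw π s) := fun t => Integrable.of_bound (hmeas t).aestronglyMeasurable _
        (Filter.Eventually.of_forall (hle t))
  have hsum : Summable fun t : ℕ =>
      ∫ ω, ‖M.γ ^ t * M.regReward τ π (ω t)‖ ∂(M.trajLaw π s) := by
    refine Summable.of_nonneg_of_le (fun t => integral_nonneg fun ω => norm_nonneg _) (fun t => ?_)
      ((summable_geometric_of_lt_one M.γ_nonneg M.γ_lt_one).mul_right B)
    refine (integral_mono (hint t).norm (integrable_const (M.γ ^ t * B)) (hle t)).trans ?_
    simp
  change ∫ ω, ∑' t : ℕ, M.γ ^ t * M.regReward τ π (ω t) ∂(M.trajLaw π s) = _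
  -- Geometric domination by `γ ^ t * B` permits exchanging the expectation and the sum over time.
  rw [← integral_tsum_of_summable_integral_norm hint hsum]
  simp only [integral_const_mul, integral_trajLaw, pairValue, ← tsum_mul_left]
  rw [← Summable.tsum_finsetSum fun a _ => (M.summable_pairValue τ π (s, a)).mul_left _]
  refine tsum_congr fun t => ?_
  rw [Finset.mul_sum]
  exact Finset.sum_congr rfl fun a _ => by ring

theorem pairValue_eq (M : FiniteMDP S A) (τ : ℝ) (π : Policy S A) (x : S × A) :
    M.pairValue τ π x = M.regReward τ π x + M.γ * ∑ s', M.P x.1 x.2 s' * M.V τ π s' := by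
  have h : ∑ s', M.P x.1 x.2 s' * M.V τ π s' = M.stepOp π (M.pairValue τ π) x := by
    simp only [stepOp_eq, V_eq_sum_pairValue]
  rw [h, pairValue, (M.summable_pairValue τ π x).tsum_eq_zero_add]
  simp only [pow_zero, one_mul, Function.iterate_zero, id_eq, stepOp, pairValue, ← tsum_mul_left]
  rw [← Summable.tsum_finsetSum fun y _ => (M.summable_pairValue τ π y).mul_left _,
    ← tsum_mul_left]
  congr 1
  refine tsum_congr fun t => ?_
  rw [Function.iterate_succ_apply', stepOp, Finset.mul_sum, Finset.mul_sum]
  exact Finset.sum_congr rfl fun a _ => by ring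

theorem Q_eq (M : FiniteMDP S A) (τ : ℝ) (π : Policy S A) (s : S) (a : A) :
    M.Q τ π s a = M.r s a + M.γ * ∑ s', M.P s a s' * M.V τ π s' := by
  simp only [Q, mul_add, Finset.sum_add_distrib, ← Finset.sum_mul, (M.P_mem s a).2, one_mul,
    Finset.mul_sum]
  congr 1
  exact Finset.sum_congr rfl fun s' _ => by ring

/-- The Bellman equation of a policy. -/
theorem V_eq_sum_Q (M : FiniteMDP S A) (τ : ℝ) (π : Policy S A) (s : S) :
    M.V τ π s = ∑ a, π.prob s a * (M.Q τ π s a - τ * Real.log (π.prob s a)) := by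
  rw [V_eq_sum_pairValue]
  refine Finset.sum_congr rfl fun a _ => ?_
  rw [pairValue_eq, Q_eq, regReward]
  ring

end Trajectory

end FiniteMDP
end

noncomputable section

/-! ### Gibbs distributions and the variational principle -/

section Softmax

variable {A : Type*} [Fintype A]

/-- The log-sum-exp function at temperature `τ`. -/
def lse (τ : ℝ) (u : A → ℝ) : ℝ := τ * Real.log (∑ a, Real.exp (u a / τ))

/-- The Gibbs distribution with potential `u` at temperature `τ`. -/
def softmax (τ : ℝ) (u : A → ℝ) (a : A) : ℝ := Real.exp ((u a - lse τ u) / τ)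

/-- The entropy regularized mean of `u` under the weights `p`. -/
def freeVal (τ : ℝ) (p u : A → ℝ) : ℝ := ∑ a, p a * (u a - τ * Real.log (p a))

theorem softmax_pos (τ : ℝ) (u : A → ℝ) (a : A) : 0 < softmax τ u a := Real.exp_pos _

theorem log_softmax (τ : ℝ) (u : A → ℝ) (a : A) :
    Real.log (softmax τ u a) = (u a - lse τ u) / τ := Real.log_exp _

theorem sum_mul_le_sum_mul {p : A → ℝ} (hp : p ∈ stdSimplex ℝ A) {u v : A → ℝ}
    (h : ∀ a, u a ≤ v a) : ∑ a, p a * u a ≤ ∑ a, p a * v a :=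
  Finset.sum_le_sum fun a _ => mul_le_mul_of_nonneg_left (h a) (hp.1 a)

theorem sum_mul_const {p : A → ℝ} (hp : p ∈ stdSimplex ℝ A) (c : ℝ) : ∑ a, p a * c = c := by
  rw [← Finset.sum_mul, hp.2, one_mul]

theorem freeVal_le_add {τ c : ℝ} {p u v : A → ℝ} (hp : p ∈ stdSimplex ℝ A)
    (h : ∀ a, u a ≤ v a + c) : freeVal τ p u ≤ freeVal τ p v + c := by
  rw [← sum_mul_const hp c, freeVal, freeVal, ← Finset.sum_add_distrib]
  simp only [← mul_add]
  exact sum_mul_le_sum_mul hp fun a => by linarith [h a]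

variable [Nonempty A]

theorem sum_exp_pos (u : A → ℝ) : 0 < ∑ a, Real.exp (u a) :=
  Finset.sum_pos (fun _ _ => Real.exp_pos _) Finset.univ_nonempty

theorem softmax_mem {τ : ℝ} (hτ : 0 < τ) (u : A → ℝ) : softmax τ u ∈ stdSimplex ℝ A := by
  refine ⟨fun a => (softmax_pos τ u a).le, ?_⟩
  have hpos := sum_exp_pos fun a => u a / τ
  simp only [softmax, lse, sub_div, mul_div_cancel_left₀ _ hτ.ne', Real.exp_sub,
    Real.exp_log hpos]
  rw [← Finset.sum_div, div_self hpos.ne']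

theorem freeVal_softmax {τ : ℝ} (hτ : 0 < τ) (u v : A → ℝ) :
    freeVal τ (softmax τ u) v = ∑ a, softmax τ u a * (v a - u a) + lse τ u := by
  rw [freeVal, ← sum_mul_const (softmax_mem hτ u) (lse τ u), ← Finset.sum_add_distrib]
  refine Finset.sum_congr rfl fun a _ => ?_
  rw [log_softmax, mul_div_cancel₀ _ hτ.ne']
  ring

/-- The Gibbs variational gap as a relative entropy. -/
theorem lse_sub_freeVal {τ : ℝ} (hτ : 0 < τ) (u : A → ℝ) {p : A → ℝ} (hp : p ∈ stdSimplex ℝ A) :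
    lse τ u - freeVal τ p u =
      τ * ∑ a, softmax τ u a * InformationTheory.klFun (p a / softmax τ u a) := by
  -- The correction terms `softmax τ u a - p a` sum to zero, as both are probability vectors; `p a =
  -- 0` needs its own case because of the logarithm.
  have h : ∀ a, softmax τ u a * InformationTheory.klFun (p a / softmax τ u a) =
      p a * (Real.log (p a) - (u a - lse τ u) / τ) + (softmax τ u a - p a) := by
    intro a
    have hq := (softmax_pos τ u a).ne'
    rw [InformationTheory.klFun_apply]
    rcases eq_or_ne (p a) 0 with h0 | h0
    · simp [h0]
    · rw [Real.log_div h0 hq, log_softmax]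
      field_simp
      ring
  simp only [h, Finset.sum_add_distrib, Finset.sum_sub_distrib, hp.2, (softmax_mem hτ u).2,
    sub_self, add_zero]
  rw [← sum_mul_const hp (lse τ u), freeVal, ← Finset.sum_sub_distrib, Finset.mul_sum]
  refine Finset.sum_congr rfl fun a _ => ?_
  rw [sum_mul_const hp]
  field_simp
  ring

theorem freeVal_le_lse {τ : ℝ} (hτ : 0 < τ) (u : A → ℝ) {p : A → ℝ} (hp : p ∈ stdSimplex ℝ A) :
    freeVal τ p u ≤ lse τ u := by
  rw [← sub_nonneg, lse_sub_freeVal hτ u hp]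
  exact mul_nonneg hτ.le (Finset.sum_nonneg fun a _ => mul_nonneg (softmax_pos τ u a).le
    (InformationTheory.klFun_nonneg (div_nonneg (hp.1 a) (softmax_pos τ u a).le)))

theorem freeVal_softmax_self {τ : ℝ} (hτ : 0 < τ) (u : A → ℝ) :
    freeVal τ (softmax τ u) u = lse τ u := by
  simp [freeVal_softmax hτ]

theorem eq_softmax_of_freeVal_eq {τ : ℝ} (hτ : 0 < τ) (u : A → ℝ) {p : A → ℝ}
    (hp : p ∈ stdSimplex ℝ A) (h : freeVal τ p u = lse τ u) : p = softmax τ u := by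
  have h0 := lse_sub_freeVal hτ u hp
  rw [h, sub_self, eq_comm, mul_eq_zero, or_iff_right hτ.ne',
    Finset.sum_eq_zero_iff_of_nonneg fun a _ => mul_nonneg (softmax_pos τ u a).le
    (InformationTheory.klFun_nonneg (div_nonneg (hp.1 a) (softmax_pos τ u a).le))] at h0
  ext a
  have ha := (mul_eq_zero.1 (h0 a (Finset.mem_univ a))).resolve_left (softmax_pos τ u a).ne'
  rw [InformationTheory.klFun_eq_zero_iff (div_nonneg (hp.1 a) (softmax_pos τ u a).le)] at ha
  exact (div_eq_one_iff_eq (softmax_pos τ u a).ne').1 ha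

theorem lse_le_add {τ : ℝ} (hτ : 0 < τ) {u v : A → ℝ} {c : ℝ} (h : ∀ a, u a ≤ v a + c) :
    lse τ u ≤ lse τ v + c := by
  rw [← freeVal_softmax_self hτ u]
  linarith [freeVal_le_add (τ := τ) (softmax_mem hτ u) h, freeVal_le_lse hτ v (softmax_mem hτ u)]

theorem lse_sub_eq {τ : ℝ} (hτ : 0 < τ) (u v : A → ℝ) :
    lse τ v - lse τ u = τ * Real.log (∑ a, softmax τ u a * Real.exp ((v a - u a) / τ)) := by
  have h : ∀ a, softmax τ u a * Real.exp ((v a - u a) / τ) =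
      Real.exp (v a / τ) / Real.exp (lse τ u / τ) := by
    intro a
    rw [softmax, ← Real.exp_add, ← Real.exp_sub]
    congr 1
    ring
  simp only [h]
  rw [← Finset.sum_div, Real.log_div (sum_exp_pos _).ne' (Real.exp_pos _).ne', Real.log_exp,
    mul_sub, mul_div_cancel₀ _ hτ.ne', lse]

/-- The first-order terms in `v - u` cancel, so the loss is quadratic for small `δ`; for large `δ` a
linear bound is already below the quadratic one. -/
theorem lse_sub_freeVal_softmax_le {τ : ℝ} (hτ : 0 < τ) {u v : A → ℝ} {δ : ℝ}
    (h : ∀ a, |v a - u a| ≤ δ) : lse τ v - freeVal τ (softmax τ u) v ≤ 2 * δ ^ 2 / τ := by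
  have hδ : 0 ≤ δ := (abs_nonneg _).trans (h (Classical.arbitrary A))
  have hp := softmax_mem hτ u
  rw [freeVal_softmax hτ]
  -- For `δ ≤ τ`, the bounds `log x ≤ x - 1` and `exp x ≤ 1 + x + x ^ 2` for `|x| ≤ 1` give even `δ
  -- ^ 2 / τ`. For `δ > τ` the loss is at most `2 * δ`, which is where the constant 2 is needed.
  rcases le_or_gt δ τ with hδτ | hδτ
  · have hpos : 0 < ∑ a, softmax τ u a * Real.exp ((v a - u a) / τ) :=
      Finset.sum_pos (fun a _ => mul_pos (softmax_pos τ u a) (Real.exp_pos _))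
        Finset.univ_nonempty
    have hb : ∀ a, |(v a - u a) / τ| ≤ δ / τ := fun a => by
      rw [abs_div, abs_of_pos hτ]
      exact div_le_div_of_nonneg_right (h a) hτ.le
    have hlog := mul_le_mul_of_nonneg_left (Real.log_le_sub_one_of_pos hpos) hτ.le
    rw [← lse_sub_eq hτ] at hlog
    have hexp : ∑ a, softmax τ u a * Real.exp ((v a - u a) / τ) ≤
        ∑ a, softmax τ u a * (1 + (v a - u a) / τ + (δ / τ) ^ 2) := by
      refine sum_mul_le_sum_mul hp fun a => ?_
      have h1 := Real.abs_exp_sub_one_sub_id_le ((hb a).trans ((div_le_one hτ).2 hδτ))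
      have h2 : ((v a - u a) / τ) ^ 2 ≤ (δ / τ) ^ 2 := sq_le_sq.2 ((hb a).trans (le_abs_self _))
      linarith [le_abs_self (Real.exp ((v a - u a) / τ) - 1 - (v a - u a) / τ)]
    have hsplit : ∑ a, softmax τ u a * (1 + (v a - u a) / τ + (δ / τ) ^ 2) =
        1 + (∑ a, softmax τ u a * (v a - u a)) / τ + (δ / τ) ^ 2 := by
      simp only [mul_add, Finset.sum_add_distrib, sum_mul_const hp, Finset.sum_div, mul_div_assoc]
    have h3 := mul_le_mul_of_nonneg_left (hexp.trans_eq hsplit) hτ.le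
    have h4 : τ * (1 + (∑ a, softmax τ u a * (v a - u a)) / τ + (δ / τ) ^ 2) =
        τ + ∑ a, softmax τ u a * (v a - u a) + δ ^ 2 / τ := by
      field_simp
    have h5 : 0 ≤ δ ^ 2 / τ := by positivity
    have h6 : 2 * δ ^ 2 / τ = δ ^ 2 / τ + δ ^ 2 / τ := by ring
    linarith
  · have h1 : lse τ v ≤ lse τ u + δ := lse_le_add hτ fun a => by linarith [(abs_le.1 (h a)).2]
    have h2 : ∑ a, softmax τ u a * (-δ) ≤ ∑ a, softmax τ u a * (v a - u a) :=
      sum_mul_le_sum_mul hp fun a => (abs_le.1 (h a)).1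
    rw [sum_mul_const hp] at h2
    have h3 : 2 * δ ≤ 2 * δ ^ 2 / τ := by
      rw [le_div_iff₀ hτ]
      nlinarith
    linarith

end Softmax
end

noncomputable section

section Softmax

variable {A : Type*} [Fintype A]

theorem freeVal_affine (τ β : ℝ) (p u v : A → ℝ) :
    freeVal τ p (fun a => (1 - β) * u a + β * v a) =
      (1 - β) * freeVal τ p u + β * freeVal τ p v := by
  simp only [freeVal, Finset.mul_sum, ← Finset.sum_add_distrib]
  exact Finset.sum_congr rfl fun a _ => by ring

theorem div_sum_eq_softmax [Nonempty A] {τ c : ℝ} (hτ : 0 < τ) (hc : c ≠ 0) {x u : A → ℝ}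
    (h : ∀ a, x a = c * Real.exp (u a / τ)) (a : A) : x a / ∑ b, x b = softmax τ u a := by
  simp only [h, ← Finset.mul_sum]
  rw [mul_div_mul_left _ _ hc, softmax, lse, sub_div, mul_div_cancel_left₀ _ hτ.ne', Real.exp_sub,
    Real.exp_log (sum_exp_pos _)]

/-- Mixing the potential of a Gibbs distribution with `v` increases its regularized mean of `v`. -/
theorem freeVal_softmax_le_mix [Nonempty A] {τ β : ℝ} (hτ : 0 < τ) (hβ : 0 < β) (hβ1 : β ≤ 1)
    (u v : A → ℝ) : freeVal τ (softmax τ u) v ≤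
      freeVal τ (softmax τ fun a => (1 - β) * u a + β * v a) v := by
  set w : A → ℝ := fun a => (1 - β) * u a + β * v a
  -- `softmax τ w` maximizes the mixture of the two free values, while `softmax τ u` maximizes the
  -- one of `u`; the gain must therefore come from `v`.
  have h1 := freeVal_le_lse hτ w (softmax_mem hτ u)
  rw [← freeVal_softmax_self hτ w, freeVal_affine, freeVal_affine, freeVal_softmax_self hτ u] at h1
  have h2 := mul_le_mul_of_nonneg_left (freeVal_le_lse hτ u (softmax_mem hτ w)) (sub_nonneg.2 hβ1)
  exact le_of_mul_le_mul_left (by linarith) hβ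

end Softmax

theorem abs_le_pi_norm {S A : Type*} [Fintype S] [Fintype A] (f : S → A → ℝ) (s : S) (a : A) :
    |f s a| ≤ ‖f‖ :=
  (norm_le_pi_norm (f s) a).trans (norm_le_pi_norm f s)

/-! ### Bellman operators, comparison and the optimal policy -/

namespace FiniteMDP

variable {S A : Type*} [Fintype S] [Fintype A]

/-- The one-step lookahead of a value function. -/
def lookahead (M : FiniteMDP S A) (W : S → ℝ) (s : S) (a : A) : ℝ :=
  M.r s a + M.γ * ∑ s', M.P s a s' * W s'

omit [Fintype A] in
theorem lookahead_le_add (M : FiniteMDP S A) {W W' : S → ℝ} {c : ℝ} (h : ∀ s, W s ≤ W' s + c)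
    (s : S) (a : A) : M.lookahead W s a ≤ M.lookahead W' s a + M.γ * c := by
  have h1 := sum_mul_le_sum_mul (M.P_mem s a) h
  simp only [mul_add, Finset.sum_add_distrib, sum_mul_const (M.P_mem s a)] at h1
  have h2 := mul_le_mul_of_nonneg_left h1 M.γ_nonneg
  simp only [lookahead]
  linarith

omit [Fintype A] in
-- Taking `c` to be the maximum of `D` and evaluating at a maximizer gives `c ≤ γ c + e`.
theorem le_div_of_contraction [Nonempty S] (M : FiniteMDP S A) {D : S → ℝ} {e : ℝ}
    (h : ∀ c, (∀ s, D s ≤ c) → ∀ s, D s ≤ M.γ * c + e) (s : S) : D s ≤ e / (1 - M.γ) := by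
  obtain ⟨s₀, hs₀⟩ := Finite.exists_max D
  refine (hs₀ s).trans ?_
  rw [le_div_iff₀ (sub_pos.2 M.γ_lt_one)]
  linarith [h (D s₀) hs₀ s₀]

/-- The entropy regularized Bellman optimality equation has a solution. -/
theorem exists_bellman_optimal [Nonempty A] (M : FiniteMDP S A) {τ : ℝ} (hτ : 0 < τ) :
    ∃ W : S → ℝ, ∀ s, W s = lse τ (M.lookahead W s) := by
  let f : (S → ℝ) → S → ℝ := fun W s => lse τ (M.lookahead W s)
  have hle : ∀ W W' : S → ℝ, ∀ s, f W s ≤ f W' s + M.γ * dist W W' := fun W W' s =>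
    lse_le_add hτ <| M.lookahead_le_add (fun s' => by
      have := (le_abs_self _).trans (dist_le_pi_dist W W' s')
      linarith) s
  have hf : ContractingWith ⟨M.γ, M.γ_nonneg⟩ f := by
    refine ⟨M.γ_lt_one, LipschitzWith.of_dist_le_mul fun W W' => ?_⟩
    refine (dist_pi_le_iff (mul_nonneg M.γ_nonneg dist_nonneg)).2 fun s => abs_le.2 ?_
    have h1 := hle W W' s
    have h2 := hle W' W s
    rw [dist_comm W' W] at h2
    change -(M.γ * dist W W') ≤ _ ∧ _ ≤ M.γ * dist W W'
    constructor <;> linarith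
  exact ⟨hf.fixedPoint, fun s => (congrFun hf.fixedPoint_isFixedPt s).symm⟩

/-- The policy with Gibbs action probabilities. -/
def gibbsPolicy [Nonempty A] {τ : ℝ} (hτ : 0 < τ) (u : S → A → ℝ) : Policy S A where
  prob s := softmax τ (u s)
  prob_mem s := softmax_mem hτ (u s)

section Trajectory

variable [MeasurableSpace S] [DiscreteMeasurableSpace S]
  [MeasurableSpace A] [DiscreteMeasurableSpace A]

theorem Q_eq_lookahead (M : FiniteMDP S A) (τ : ℝ) (π : Policy S A) :
    M.Q τ π = M.lookahead (M.V τ π) := by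
  ext s a
  exact M.Q_eq τ π s a

theorem V_eq_freeVal (M : FiniteMDP S A) (τ : ℝ) (π : Policy S A) (s : S) :
    M.V τ π s = freeVal τ (π.prob s) (M.lookahead (M.V τ π) s) := by
  rw [V_eq_sum_Q, Q_eq_lookahead, freeVal]

variable [Nonempty S]

/-- Comparison principle: by monotonicity the one-step defect `e` is discounted at each further
step, and the geometric series gives `e / (1 - γ)`. -/
theorem le_V_add (M : FiniteMDP S A) {τ e : ℝ} {π : Policy S A} {W : S → ℝ}
    (h : ∀ s, W s ≤ freeVal τ (π.prob s) (M.lookahead W s) + e) (s : S) :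
    W s ≤ M.V τ π s + e / (1 - M.γ) := by
  have := M.le_div_of_contraction (D := fun s => W s - M.V τ π s) (e := e) (fun c hc s => by
    have h1 := freeVal_le_add (τ := τ) (π.prob_mem s)
      (M.lookahead_le_add (W := W) (W' := M.V τ π) (c := c) (fun s => by linarith [hc s]) s)
    rw [← V_eq_freeVal] at h1
    linarith [h s]) s
  linarith

theorem V_le (M : FiniteMDP S A) {τ : ℝ} {π : Policy S A} {W : S → ℝ}
    (h : ∀ s, freeVal τ (π.prob s) (M.lookahead W s) ≤ W s) (s : S) : M.V τ π s ≤ W s := by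
  have := M.le_div_of_contraction (D := fun s => M.V τ π s - W s) (e := 0) (fun c hc s => by
    have h1 := freeVal_le_add (τ := τ) (π.prob_mem s)
      (M.lookahead_le_add (W := M.V τ π) (W' := W) (c := c) (fun s => by linarith [hc s]) s)
    rw [← V_eq_freeVal] at h1
    linarith [h s]) s
  rw [zero_div] at this
  linarith

variable [Nonempty A]

theorem V_le_of_bellman_optimal (M : FiniteMDP S A) {τ : ℝ} (hτ : 0 < τ) {W : S → ℝ}
    (hW : ∀ s, W s = lse τ (M.lookahead W s)) (π : Policy S A) (s : S) : M.V τ π s ≤ W s :=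
  M.V_le (fun s => (freeVal_le_lse hτ _ (π.prob_mem s)).trans_eq (hW s).symm) s

theorem V_gibbsPolicy_of_bellman_optimal (M : FiniteMDP S A) {τ : ℝ} (hτ : 0 < τ) {W : S → ℝ}
    (hW : ∀ s, W s = lse τ (M.lookahead W s)) : M.V τ (gibbsPolicy hτ (M.lookahead W)) = W := by
  ext s
  refine le_antisymm (M.V_le_of_bellman_optimal hτ hW _ s) ?_
  have := M.le_V_add (τ := τ) (e := 0) (π := gibbsPolicy hτ (M.lookahead W)) (W := W)
    (fun s => by
      rw [add_zero, hW s]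
      exact (freeVal_softmax_self hτ _).symm.le) s
  simpa using this

theorem V_eq_of_isOptimal (M : FiniteMDP S A) {τ : ℝ} (hτ : 0 < τ) {W : S → ℝ}
    (hW : ∀ s, W s = lse τ (M.lookahead W s)) {π : Policy S A} (hπ : M.IsOptimal τ π) :
    M.V τ π = W := by
  ext s
  refine le_antisymm (M.V_le_of_bellman_optimal hτ hW π s) ?_
  have := hπ (gibbsPolicy hτ (M.lookahead W)) s
  rwa [V_gibbsPolicy_of_bellman_optimal M hτ hW] at this

theorem V_eq_lse_of_isOptimal (M : FiniteMDP S A) {τ : ℝ} (hτ : 0 < τ) {π : Policy S A}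
    (hπ : M.IsOptimal τ π) (s : S) : M.V τ π s = lse τ (M.Q τ π s) := by
  obtain ⟨W, hW⟩ := M.exists_bellman_optimal hτ
  rw [Q_eq_lookahead, M.V_eq_of_isOptimal hτ hW hπ]
  exact hW s

/-- The value of an optimal policy is both its free value and the log-sum-exp of its `Q`, so this is
the equality case of the variational principle. -/
theorem prob_eq_softmax_of_isOptimal (M : FiniteMDP S A) {τ : ℝ} (hτ : 0 < τ) {π : Policy S A}
    (hπ : M.IsOptimal τ π) (s : S) : π.prob s = softmax τ (M.Q τ π s) := by
  refine eq_softmax_of_freeVal_eq hτ _ (π.prob_mem s) ?_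
  rw [← V_eq_lse_of_isOptimal M hτ hπ, Q_eq_lookahead, ← V_eq_freeVal]

theorem existsUnique_isOptimal (M : FiniteMDP S A) {τ : ℝ} (hτ : 0 < τ) :
    ∃! π : Policy S A, M.IsOptimal τ π := by
  obtain ⟨W, hW⟩ := M.exists_bellman_optimal hτ
  refine ⟨gibbsPolicy hτ (M.lookahead W), fun π s => ?_, fun π hπ => ?_⟩
  · rw [M.V_gibbsPolicy_of_bellman_optimal hτ hW]
    exact M.V_le_of_bellman_optimal hτ hW π s
  · ext s a
    rw [M.prob_eq_softmax_of_isOptimal hτ hπ, Q_eq_lookahead, M.V_eq_of_isOptimal hτ hW hπ]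
    rfl

/-! ### Entropy softmax NPG in terms of potentials -/

omit [Nonempty S] in
theorem npgStep_prob (M : FiniteMDP S A) {τ η : ℝ} (hτ : 0 < τ) (hη : 0 < η) {π : Policy S A}
    {u : S → A → ℝ} (hu : ∀ s, π.prob s = softmax τ (u s)) (s : S) :
    (M.npgStep τ η π).prob s = softmax τ fun a =>
      (1 - η * τ / (η * τ + 1)) * u s a + η * τ / (η * τ + 1) * M.Q τ π s a := by
  ext a
  -- The prefactor collects the terms of the exponent that do not depend on the action; the rest is
  -- the mixed potential divided by `τ`.
  refine div_sum_eq_softmax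
    (x := fun b => π.prob s b * Real.exp (η / (η * τ + 1) * M.adv τ π s b)) hτ (Real.exp_ne_zero
    (-lse τ (u s) / τ + η / (η * τ + 1) * (lse τ (u s) - M.V τ π s))) (fun b => ?_) a
  have h : η * τ + 1 ≠ 0 := by positivity
  rw [adv, hu, log_softmax, softmax, ← Real.exp_add, ← Real.exp_add]
  congr 1
  field_simp
  ring

theorem V_le_V_npgStep (M : FiniteMDP S A) {τ η : ℝ} (hτ : 0 < τ) (hη : 0 < η) {π : Policy S A}
    {u : S → A → ℝ} (hu : ∀ s, π.prob s = softmax τ (u s)) (s : S) :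
    M.V τ π s ≤ M.V τ (M.npgStep τ η π) s := by
  have := M.le_V_add (τ := τ) (e := 0) (π := M.npgStep τ η π) (W := M.V τ π) (fun s => by
    have hβ : η * τ / (η * τ + 1) ≤ 1 := (div_le_one (by positivity)).2 (by linarith)
    rw [add_zero, M.npgStep_prob hτ hη hu, V_eq_freeVal, hu s, Q_eq_lookahead]
    exact freeVal_softmax_le_mix hτ (by positivity) hβ _ _) s
  simpa using this

omit [Nonempty S] [Nonempty A] in
theorem Q_mono (M : FiniteMDP S A) {τ : ℝ} {π π' : Policy S A} {c : ℝ}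
    (h : ∀ s, M.V τ π s ≤ M.V τ π' s + c) (s : S) (a : A) :
    M.Q τ π s a ≤ M.Q τ π' s a + M.γ * c := by
  rw [Q_eq_lookahead, Q_eq_lookahead]
  exact M.lookahead_le_add h s a

/-- Potentials of the entropy softmax NPG iterates, normalized so that they converge to the optimal
action values. -/
def npgLogits (M : FiniteMDP S A) (τ η : ℝ) (πstar π₀ : Policy S A) : ℕ → S → A → ℝ
  | 0 => fun s a => τ * Real.log (π₀.prob s a) + M.V τ πstar s
  | k + 1 => fun s a => (1 - η * τ / (η * τ + 1)) * npgLogits M τ η πstar π₀ k s a +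
      η * τ / (η * τ + 1) * M.Q τ (M.npgIter τ η π₀ k) s a

omit [Nonempty S] in
theorem npgIter_prob (M : FiniteMDP S A) {τ η : ℝ} (hτ : 0 < τ) (hη : 0 < η)
    (πstar : Policy S A) {π₀ : Policy S A} (hπ₀ : ∀ s a, 0 < π₀.prob s a) (k : ℕ) (s : S) :
    (M.npgIter τ η π₀ k).prob s = softmax τ (M.npgLogits τ η πstar π₀ k s) := by
  induction k generalizing s with
  | zero =>
    ext a
    rw [← div_sum_eq_softmax (x := π₀.prob s) hτ (Real.exp_ne_zero (-M.V τ πstar s / τ))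
      (fun b => ?_), (π₀.prob_mem s).2, div_one]
    · rfl
    · rw [npgLogits, ← Real.exp_add, ← add_div, neg_add_cancel_comm_assoc,
        mul_div_cancel_left₀ _ hτ.ne', Real.exp_log (hπ₀ s b)]
  | succ k ih => exact M.npgStep_prob hτ hη ih s

/-- The value gap is at most `d + b`: replacing `Q*` by `u` in the log-sum-exp costs `d`, and `lse τ
u` is the free value of `u` under `π`, which exceeds that of `Q^π` by at most `b`. One lookahead
then contributes the factor `γ`. -/
theorem Q_star_le_add (M : FiniteMDP S A) {τ : ℝ} (hτ : 0 < τ) {πstar π : Policy S A}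
    (hstar : M.IsOptimal τ πstar) {u : S → A → ℝ} (hu : ∀ s, π.prob s = softmax τ (u s))
    {d b : ℝ} (hd : ∀ s a, |M.Q τ πstar s a - u s a| ≤ d)
    (hb : ∀ s a, u s a ≤ M.Q τ π s a + b) (s : S) (a : A) :
    M.Q τ πstar s a ≤ M.Q τ π s a + M.γ * (d + b) := by
  refine M.Q_mono (fun s => ?_) s a
  have h1 : lse τ (M.Q τ πstar s) ≤ lse τ (u s) + d :=
    lse_le_add hτ fun a => by linarith [(abs_le.1 (hd s a)).2]
  have h2 := freeVal_le_add (τ := τ) (softmax_mem hτ (u s)) (hb s)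
  rw [freeVal_softmax_self hτ, ← hu, Q_eq_lookahead, ← V_eq_freeVal] at h2
  rw [V_eq_lse_of_isOptimal M hτ hstar]
  linarith

/-- The one-sided bound `b` is tracked beside `d` because `d` alone does not close the recursion:
the new potential involves `Q^k`, whose distance to `Q*` is controlled only through `d + b`. -/
theorem npgLogits_error (M : FiniteMDP S A) {τ η : ℝ} (hτ : 0 < τ) (hη : 0 < η)
    {πstar π₀ : Policy S A} (hstar : M.IsOptimal τ πstar) (hπ₀ : ∀ s a, 0 < π₀.prob s a) (k : ℕ) :
    ∃ d b : ℝ, 0 ≤ b ∧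
      (∀ s a, |M.Q τ πstar s a - M.npgLogits τ η πstar π₀ (k + 1) s a| ≤ d) ∧
      (∀ s a, M.npgLogits τ η πstar π₀ (k + 1) s a ≤ M.Q τ (M.npgIter τ η π₀ (k + 1)) s a + b) ∧
      d + b ≤ M.C₁ τ η πstar π₀ * (1 - (1 - M.γ) * (η * τ / (η * τ + 1))) ^ k := by
  have hβ0 : 0 ≤ η * τ / (η * τ + 1) := by positivity
  have hβ1 : 0 ≤ 1 - η * τ / (η * τ + 1) :=
    sub_nonneg.2 ((div_le_one (by positivity)).2 (by linarith))
  have hstep : ∀ (k : ℕ) (d e b : ℝ), 0 ≤ b →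
      (∀ s a, |M.Q τ πstar s a - M.npgLogits τ η πstar π₀ k s a| ≤ d) →
      (∀ s a, |M.Q τ πstar s a - M.Q τ (M.npgIter τ η π₀ k) s a| ≤ e) →
      (∀ s a, M.npgLogits τ η πstar π₀ k s a ≤ M.Q τ (M.npgIter τ η π₀ k) s a + b) →
      0 ≤ (1 - η * τ / (η * τ + 1)) * b ∧
      (∀ s a, |M.Q τ πstar s a - M.npgLogits τ η πstar π₀ (k + 1) s a| ≤
        (1 - η * τ / (η * τ + 1)) * d + η * τ / (η * τ + 1) * e) ∧
      (∀ s a, M.npgLogits τ η πstar π₀ (k + 1) s a ≤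
        M.Q τ (M.npgIter τ η π₀ (k + 1)) s a + (1 - η * τ / (η * τ + 1)) * b) := by
    intro k d e b hb hd he hLb
    refine ⟨mul_nonneg hβ1 hb, fun s a => ?_, fun s a => ?_⟩
    · have h1 := mul_le_mul_of_nonneg_left (hd s a) hβ1
      have h2 := mul_le_mul_of_nonneg_left (he s a) hβ0
      rw [← abs_of_nonneg hβ1, ← abs_mul, abs_of_nonneg hβ1] at h1
      rw [← abs_of_nonneg hβ0, ← abs_mul, abs_of_nonneg hβ0] at h2
      refine le_trans (le_of_eq ?_) ((abs_add_le _ _).trans (add_le_add h1 h2))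
      rw [npgLogits]
      congr 1
      ring
    -- The new potential is at most `Q^k + (1-β) b`, and `Q^k ≤ Q^{k+1}` by policy improvement.
    · have h0 : ∀ s, M.V τ (M.npgIter τ η π₀ k) s ≤ M.V τ (M.npgIter τ η π₀ (k + 1)) s + 0 :=
        fun s => (M.V_le_V_npgStep hτ hη (M.npgIter_prob hτ hη πstar hπ₀ k) s).trans_eq
          (add_zero _).symm
      have h1 := M.Q_mono h0 s a
      have h2 := mul_le_mul_of_nonneg_left (hLb s a) hβ1
      rw [npgLogits]
      linarith
  induction k with
  | zero =>
    have he : ∀ s a, |M.Q τ πstar s a - M.Q τ (M.npgIter τ η π₀ 0) s a| ≤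
        ‖M.Q τ πstar - M.Q τ π₀‖ := fun s a =>
      abs_le_pi_norm (M.Q τ πstar - M.Q τ π₀) s a
    set l := ‖(fun (s : S) (a : A) => Real.log (πstar.prob s a) - Real.log (π₀.prob s a))‖ with hl
    -- Since `τ log π* = Q* - V*`, the shift by `V*` in the initial potential makes this difference
    -- exactly `τ (log π* - log π⁰)`.
    have hd : ∀ s a, |M.Q τ πstar s a - M.npgLogits τ η πstar π₀ 0 s a| ≤ τ * l := by
      intro s a
      have h1 : |Real.log (πstar.prob s a) - Real.log (π₀.prob s a)| ≤ l :=
        abs_le_pi_norm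
          (fun (s : S) (a : A) => Real.log (πstar.prob s a) - Real.log (π₀.prob s a)) s a
      have h2 := mul_le_mul_of_nonneg_left h1 hτ.le
      rw [← abs_of_pos hτ, ← abs_mul, abs_of_pos hτ, M.prob_eq_softmax_of_isOptimal hτ hstar,
        log_softmax, ← V_eq_lse_of_isOptimal M hτ hstar, mul_sub, mul_div_cancel₀ _ hτ.ne'] at h2
      rw [npgLogits, ← sub_sub, sub_right_comm]
      exact h2
    -- The initial `b` is the triangle inequality through `Q*`. Writing `q` for the initial
    -- `Q`-error, the sum after one step is `(1-β)τl + βq + (1-β)(q + τl) = q + 2τ(1-β)l`, which is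
    -- `C₁`; this is why the induction starts at iterate 1.
    obtain ⟨h1, h2, h3⟩ := hstep 0 _ _ (‖M.Q τ πstar - M.Q τ π₀‖ + τ * l) (by positivity) hd he
      fun s a => by linarith [(abs_le.1 (he s a)).2, (abs_le.1 (hd s a)).1]
    refine ⟨_, _, h1, h2, h3, le_of_eq ?_⟩
    rw [C₁, ← hl, add_comm 1 (η * τ)]
    ring
  | succ k ih =>
    obtain ⟨d, b, hb, hd, hLb, hle⟩ := ih
    have he : ∀ s a, |M.Q τ πstar s a - M.Q τ (M.npgIter τ η π₀ (k + 1)) s a| ≤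
        M.γ * (d + b) := by
      intro s a
      have h1 := M.Q_star_le_add hτ hstar (M.npgIter_prob hτ hη πstar hπ₀ (k + 1)) hd hLb s a
      have h0 : ∀ s, M.V τ (M.npgIter τ η π₀ (k + 1)) s ≤ M.V τ πstar s + 0 :=
        fun s => (hstar _ s).trans_eq (add_zero _).symm
      have h2 := M.Q_mono h0 s a
      rw [abs_of_nonneg (by linarith)]
      linarith
    obtain ⟨h1, h2, h3⟩ := hstep (k + 1) d _ b hb hd he hLb
    refine ⟨_, _, h1, h2, h3, ?_⟩
    have hρ : 0 ≤ 1 - (1 - M.γ) * (η * τ / (η * τ + 1)) := by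
      nlinarith [mul_nonneg M.γ_nonneg hβ0]
    -- The new sum is `(1-β)d + βγ(d+b) + (1-β)b`.
    calc _ = (1 - (1 - M.γ) * (η * τ / (η * τ + 1))) * (d + b) := by ring
      _ ≤ _ := mul_le_mul_of_nonneg_left hle hρ
      _ = _ := by ring

/-- The quadratic loss is the one-step Bellman defect of `V*` under `π`, to which the comparison
principle applies. -/
theorem V_star_le_add (M : FiniteMDP S A) {τ : ℝ} (hτ : 0 < τ) {πstar π : Policy S A}
    (hstar : M.IsOptimal τ πstar) {u : S → A → ℝ} (hu : ∀ s, π.prob s = softmax τ (u s))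
    {d : ℝ} (hd : ∀ s a, |M.Q τ πstar s a - u s a| ≤ d) (s : S) :
    M.V τ πstar s ≤ M.V τ π s + 2 * d ^ 2 / τ / (1 - M.γ) := by
  refine M.le_V_add (fun s => ?_) s
  have h := lse_sub_freeVal_softmax_le hτ (hd s)
  rw [← hu, ← V_eq_lse_of_isOptimal M hτ hstar, Q_eq_lookahead] at h
  linarith

end Trajectory

end FiniteMDP

end

theorem theorem6p11 {S A : Type*} [Fintype S] [Nonempty S] [Fintype A] [Nonempty A]
    [MeasurableSpace S] [DiscreteMeasurableSpace S] [MeasurableSpace A] [DiscreteMeasurableSpace A]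
    (M : FiniteMDP S A) (τ η : ℝ) (hτ : 0 < τ) (hη : 0 < η)
    (π₀ : Policy S A) (hπ₀ : ∀ s a, 0 < π₀.prob s a) :
    (∃! πstar : Policy S A, M.IsOptimal τ πstar) ∧
    ∀ πstar : Policy S A, M.IsOptimal τ πstar → ∀ k : ℕ, 1 ≤ k →
      ‖M.V τ πstar - M.V τ (M.npgIter τ η π₀ k)‖ ≤
        2 * M.C₁ τ η πstar π₀ ^ 2 / ((1 - M.γ) * τ) *
          (1 - (1 - M.γ) * (η * τ / (η * τ + 1))) ^ (2 * (k - 1)) := by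
  refine ⟨M.existsUnique_isOptimal hτ, fun πstar hstar k hk => ?_⟩
  obtain ⟨k, rfl⟩ := Nat.exists_eq_add_of_le' hk
  obtain ⟨d, b, hb, hd, -, hle⟩ := M.npgLogits_error hτ hη hstar hπ₀ k
  have hγ := sub_pos.2 M.γ_lt_one
  have hd0 : 0 ≤ d :=
    (abs_nonneg _).trans (hd (Classical.arbitrary S) (Classical.arbitrary A))
  -- Only `d ≤ d + b` is kept, and `0 ≤ d` makes squaring monotone.
  have hsq : d ^ 2 ≤ (M.C₁ τ η πstar π₀ * (1 - (1 - M.γ) * (η * τ / (η * τ + 1))) ^ k) ^ 2 :=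
    pow_le_pow_left₀ hd0 (by linarith) 2
  have hbound : 2 * d ^ 2 / τ / (1 - M.γ) ≤ 2 * M.C₁ τ η πstar π₀ ^ 2 / ((1 - M.γ) * τ) *
      (1 - (1 - M.γ) * (η * τ / (η * τ + 1))) ^ (2 * (k + 1 - 1)) := by
    rw [Nat.add_sub_cancel, pow_mul', div_div, mul_comm τ, div_mul_eq_mul_div, mul_assoc,
      ← mul_pow]
    gcongr
  have hnn : 0 ≤ 2 * d ^ 2 / τ / (1 - M.γ) := by positivity
  refine (pi_norm_le_iff_of_nonneg (hnn.trans hbound)).2 fun s => ?_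
  have h1 := M.V_star_le_add hτ hstar (M.npgIter_prob hτ hη πstar hπ₀ (k + 1)) hd s
  rw [Pi.sub_apply, Real.norm_of_nonneg (sub_nonneg.2 (hstar _ s))]
  linarith
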